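/- **Definitions.** A map $F:\mathbb{R}^n\to\mathbb{R}^n$ ($n>0$) is *everywhere defined rational* if each of its components can be written as $p/q$ with $p,q\in\mathbb{R}[x_1,\dots,x_n]$ and $q$ vanishing nowhere on $\mathbb{R}^n$. It is *nonsingular* if its Jacobian determinant exists and is nonzero at every point of $\mathbb{R}^n$. A *birational automorphism* of $\mathbb{R}^n$ is an everywhere defined rational bijection $\mathbb{R}^n\to\mathbb{R}^n$ whose inverse is everywhere defined rational. *Birational stable equivalence* is the equivalence relation, on the set of all maps $\mathbb{R}^n\to\mathbb{R}^n$ in all dimensions $n>0$, generated by: (1) $F\sim A\circ F\circ B$ for $F:\mathbb{R}^n\to\mathbb{R}^n$ and birational automorphisms $A,B$ of $\mathbb{R}^n$; (2) $F=(f_1,\dots,f_n)\sim(f_1,\dots,f_n,x_{n+1},\dots,x_m)$ for any $m>n$. *Segre equivalence* is the equivalence relation, on the set of real analytic maps $\mathbb{R}^n\to\mathbb{R}^n$ fixing $0$, in all dimensions $n>0$, generated by $F\sim G$, where $G:\mathbb{R}^{n+1}\to\mathbb{R}^{n+1}$ is given by $G(x,t)=(F(tx)/t,\,t)$, the first component being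 $F'(0)x$ at $t=0$. The *coimage* of $F:\mathbb{R}^n\to\mathbb{R}^n$ is $\mathbb{R}^n\setminus F(\mathbb{R}^n)$. For everywhere defined rational $F$ it is a semialgebraic set. The dimension of a semialgebraic set $S\subseteq\mathbb{R}^n$ is the Krull dimension of $\mathbb{R}[x_1,\dots,x_n]/I(S)$, where $I(S)$ is the ideal of polynomials vanishing on $S$, and its codimension is $n-\dim S$; the empty set has codimension $\infty$. **Theorem.** Let $n,m>0$ and let $F:\mathbb{R}^n\to\mathbb{R}^n$ and $G:\mathbb{R}^m\to\mathbb{R}^m$ be everywhere defined rational nonsingular maps. If $F$ and $G$ are birationally stably equivalent or Segre equivalent, then the codimension of the coimage of $F$ in $\mathbb{R}^n$ equals the codimension of the coimage of $G$ in $\mathbb{R}^m$. -/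

import Mathlib

namespace RealMaps

/-- The maps `ℝⁿ → ℝⁿ`. -/
abbrev Endo (n : ℕ) : Type := (Fin n → ℝ) → (Fin n → ℝ)

/-- The maps `ℝⁿ → ℝⁿ` in all dimensions. -/
abbrev AnyEndo : Type := Σ n : ℕ, Endo n

/-- Everywhere defined rational maps: each component is a quotient of two polynomials whose
denominator vanishes nowhere on `ℝⁿ`. -/
def EverywhereDefinedRational {n : ℕ} (F : Endo n) : Prop :=
  ∀ i : Fin n, ∃ p q : MvPolynomial (Fin n) ℝ,
    (∀ x, MvPolynomial.eval x q ≠ 0) ∧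
      ∀ x, F x i = MvPolynomial.eval x p / MvPolynomial.eval x q

/-- Nonsingular maps: the derivative exists everywhere and the Jacobian determinant vanishes
nowhere. -/
def Nonsingular {n : ℕ} (F : Endo n) : Prop :=
  Differentiable ℝ F ∧ ∀ x, (fderiv ℝ F x).det ≠ 0

/-- Birational automorphisms of `ℝⁿ`: everywhere defined rational bijections whose inverse is
everywhere defined rational. -/
def IsBirationalAut {n : ℕ} (A : Equiv.Perm (Fin n → ℝ)) : Prop :=
  EverywhereDefinedRational (A : Endo n) ∧ EverywhereDefinedRational (A.symm : Endo n)

/-- The extension `(f₁, …, fₙ, xₙ₊₁, …, xₙ₊ₖ)` of `F = (f₁, …, fₙ)` by `k` fresh variables. -/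
def freshExtension {n : ℕ} (k : ℕ) (F : Endo n) : Endo (n + k) := fun x =>
  Fin.append (F fun i => x (Fin.castAdd k i)) (fun j => x (Fin.natAdd n j))

/-- The generating relations of birational stable equivalence. -/
inductive BirationalStableStep : AnyEndo → AnyEndo → Prop
  | coordinateChange {n : ℕ} (hn : 0 < n) (F : Endo n) (A B : Equiv.Perm (Fin n → ℝ))
      (hA : IsBirationalAut A) (hB : IsBirationalAut B) :
      BirationalStableStep ⟨n, F⟩ ⟨n, A ∘ F ∘ B⟩
  | fresh {n k : ℕ} (hn : 0 < n) (hk : 0 < k) (F : Endo n) :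
      BirationalStableStep ⟨n, F⟩ ⟨n + k, freshExtension k F⟩

/-- Birational stable equivalence: the equivalence relation, on the maps `ℝⁿ → ℝⁿ` in all
dimensions `n > 0`, generated by the steps above. -/
def BirationallyStablyEquivalent {n m : ℕ} (F : Endo n) (G : Endo m) : Prop :=
  Relation.EqvGen BirationalStableStep ⟨n, F⟩ ⟨m, G⟩

/-- The real analytic maps `ℝⁿ → ℝⁿ`, `n > 0`, that fix `0`. -/
def IsAnalyticFixingZero {n : ℕ} (F : Endo n) : Prop :=
  0 < n ∧ AnalyticOnNhd ℝ F Set.univ ∧ F 0 = 0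

/-- The map `G(x, t) = (F(tx)/t, t)` of `ℝⁿ⁺¹`, where at `t = 0` the first component stands for
its limit `F'(0) x`. The variable `t` is the last coordinate. -/
noncomputable def segreExtension {n : ℕ} (F : Endo n) : Endo (n + 1) := fun z =>
  let x : Fin n → ℝ := Fin.init z
  let t : ℝ := z (Fin.last n)
  Fin.snoc (α := fun _ => ℝ) (if t = 0 then fderiv ℝ F 0 x else t⁻¹ • F (t • x)) t

/-- The generating relation of Segre equivalence. -/
inductive SegreStep : AnyEndo → AnyEndo → Prop
  | segre {n : ℕ} (F : Endo n) (hF : IsAnalyticFixingZero F) :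
      SegreStep ⟨n, F⟩ ⟨n + 1, segreExtension F⟩

/-- Segre equivalence: the equivalence relation, on the real analytic endomorphisms of `ℝⁿ`
(`n > 0`) that fix `0`, generated by the steps above. -/
def SegreEquivalent {n m : ℕ} (F : Endo n) (G : Endo m) : Prop :=
  IsAnalyticFixingZero F ∧ IsAnalyticFixingZero G ∧ Relation.EqvGen SegreStep ⟨n, F⟩ ⟨m, G⟩

/-- The coimage `ℝⁿ \ F(ℝⁿ)`. -/
def coimage {n : ℕ} (F : Endo n) : Set (Fin n → ℝ) := (Set.range F)ᶜ

/-- The dimension of a semialgebraic set `S ⊆ ℝⁿ`: the Krull dimension of its ring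
`ℝ[x₁, …, xₙ] / I(S)` of polynomial functions (`⊥`, that is `-∞`, for the empty set).
The coimage of an everywhere defined rational map is semialgebraic (Tarski-Seidenberg). -/
noncomputable def semialgDim {n : ℕ} (S : Set (Fin n → ℝ)) : WithBot ℕ∞ :=
  ringKrullDim (MvPolynomial (Fin n) ℝ ⧸ MvPolynomial.vanishingIdeal ℝ S)

open Classical in
/-- The codimension `n - dim S` of a semialgebraic set `S ⊆ ℝⁿ`; the empty set, of dimension
`-∞`, has codimension `∞`. -/
noncomputable def semialgCodim {n : ℕ} (S : Set (Fin n → ℝ)) : ℕ∞ :=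
  if S = ∅ then ⊤ else (n : ℕ∞) - (semialgDim S).unbotD 0

/-- The dimension is at most `n`, so the subtraction in `semialgCodim` never truncates. -/
theorem semialgDim_le {n : ℕ} (S : Set (Fin n → ℝ)) : semialgDim S ≤ n := by
  refine (ringKrullDim_quotient_le _).trans ?_
  rw [MvPolynomial.ringKrullDim_of_isNoetherianRing, ringKrullDim_eq_zero_of_field]
  simp

end RealMaps

/-! Each generating step alters the coimage in a way that preserves codimension. A coordinate change
moves it by a birational automorphism, and `k` fresh variables multiply it by `ℝᵏ`. If `F'(0)` is
onto, the image of the Segre extension swallows the hyperplane `t = 0`, and off it `(x, t) ↦ (x/t,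
t)` carries `coimage F × (ℝ \ {0})` onto the new coimage.

Two facts about dimension then suffice. A map rational on a set does not raise its dimension
(`semialgDim_image_le`, by comparing transcendence degrees in
`ringKrullDim_le_of_injective_of_fractions`), and a product with a Zariski dense subset of `ℝᵏ` adds
`k` (`semialgDim_prod`).

The intermediate maps of a Segre chain need not be nonsingular, but surjectivity of the derivative
at `0` passes along every step in both directions. -/

/-! ### Krull dimension and transcendence degree. -/

theorem ringKrullDim_le_of_isIntegral {R S : Type*} [CommRing R] [CommRing S] [Algebra R S]
    [Algebra.IsIntegral R S] : ringKrullDim S ≤ ringKrullDim R :=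
  Order.krullDim_le_of_strictMono (PrimeSpectrum.comap (algebraMap R S)) fun _ _ h =>
    Ideal.IsIntegral.comap_lt_comap h

/-- Lying over gives a prime above the bottom of a chain, and going up lifts the rest. -/
theorem ringKrullDim_le_of_isIntegral_of_injective {R S : Type*} [CommRing R] [CommRing S]
    [Algebra R S] [Algebra.IsIntegral R S] (h : Function.Injective (algebraMap R S)) :
    ringKrullDim R ≤ ringKrullDim S := by
  refine iSup_le fun l => ?_
  obtain ⟨Q, -, hQ, hQl⟩ := Ideal.exists_ideal_over_prime_of_isIntegral l.head.asIdeal (⊥ : Ideal S)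
    (by rw [Ideal.comap_bot_of_injective _ h]; exact bot_le)
  have : Q.LiesOver l.head.asIdeal := ⟨hQl.symm⟩
  obtain ⟨L, hL, -⟩ := Ideal.exists_ltSeries_of_hasGoingUp l Q
  rw [← hL]
  exact Order.LTSeries.length_le_krullDim L

/-- The dimension of a finitely generated domain over a field is at least its transcendence
degree. -/
theorem natCast_le_ringKrullDim_of_le_trdeg {k A : Type*} [Field k] [CommRing A] [IsDomain A]
    [Algebra k A] [Algebra.FiniteType k A] {s : ℕ} (hs : (s : Cardinal) ≤ Algebra.trdeg k A) :
    (s : WithBot ℕ∞) ≤ ringKrullDim A := by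
  obtain ⟨r, g, hg, hint⟩ := exists_integral_inj_algHom_of_fg k A
  algebraize [g.toRingHom]
  have : IsScalarTower k (MvPolynomial (Fin r) k) A := .of_algHom g
  have : FaithfulSMul (MvPolynomial (Fin r) k) A := (faithfulSMul_iff_algebraMap_injective _ _).2 hg
  have h := lift_trdeg_add_eq k (MvPolynomial (Fin r) k) A
  rw [trdeg_eq_zero (R := MvPolynomial (Fin r) k), MvPolynomial.trdeg_of_isDomain] at h
  simp only [Cardinal.mk_fin, Cardinal.lift_natCast, Cardinal.lift_zero, add_zero] at h
  have hsr : s ≤ r := by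
    have h' := Cardinal.lift_le.{_}.2 hs
    rw [← h] at h'
    simpa using h'
  refine le_trans ?_ (ringKrullDim_le_of_isIntegral_of_injective
    (R := MvPolynomial (Fin r) k) hg)
  rw [MvPolynomial.ringKrullDim_of_isNoetherianRing, ringKrullDim_eq_zero_of_field]
  simpa using hsr

/-- Noether normalization of `B` puts `s ≥ dim B` algebraically independent elements in `C`. They
stay independent modulo a suitable prime `Q`, and `C ⧸ Q` is algebraic over the image of `A`, so a
quotient domain of `A` has transcendence degree at least `s`. Finite generation is needed only of
`A` and `B`, not of `C`. -/
theorem ringKrullDim_le_of_injective_of_fractions {k A B C : Type*} [Field k] [CommRing A]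
    [CommRing B] [CommRing C] [Algebra k A] [Algebra k B] [Algebra k C]
    [Algebra.FiniteType k A] [Algebra.FiniteType k B] (f : A →ₐ[k] C) (g : B →ₐ[k] C)
    (hg : Function.Injective g) (hf : ∀ c, ∃ a b, IsUnit (f a) ∧ f a * c = f b) :
    ringKrullDim B ≤ ringKrullDim A := by
  nontriviality B
  obtain ⟨s, u, hu, hint⟩ := exists_integral_inj_algHom_of_fg k B
  have hB : ringKrullDim B ≤ s := by
    algebraize [u.toRingHom]
    refine (ringKrullDim_le_of_isIntegral (R := MvPolynomial (Fin s) k)).trans ?_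
    rw [MvPolynomial.ringKrullDim_of_isNoetherianRing, ringKrullDim_eq_zero_of_field]
    simp
  refine hB.trans ?_
  let v : MvPolynomial (Fin s) k →ₐ[k] C := g.comp u
  have hv : Function.Injective v := hg.comp hu
  -- `C` need not be a domain; a minimal prime, here zero, always lifts along an injection.
  obtain ⟨Q, hQ, hQv⟩ := Ideal.exists_comap_eq_of_mem_minimalPrimes_of_injective
    (f := v.toRingHom) hv ⊥ (by simp [IsDomain.minimalPrimes_eq_singleton_bot])
  let P : Ideal A := Q.comap f
  have : P.IsPrime := Ideal.comap_isPrime f Q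
  let e : A ⧸ P →ₐ[k] C ⧸ Q := Ideal.quotientMapₐ Q f le_rfl
  have he : Function.Injective e := Ideal.quotientMap_injective
  algebraize [e.toRingHom]
  have : IsScalarTower k (A ⧸ P) (C ⧸ Q) := .of_algHom e
  have : FaithfulSMul (A ⧸ P) (C ⧸ Q) := (faithfulSMul_iff_algebraMap_injective _ _).2 he
  have halg : Algebra.IsAlgebraic (A ⧸ P) (C ⧸ Q) := by
    refine ⟨fun c => ?_⟩
    obtain ⟨c, rfl⟩ := Ideal.Quotient.mk_surjective c
    obtain ⟨a, b, ha, hab⟩ := hf c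
    have ha' : Ideal.Quotient.mk P a ≠ 0 := by
      rw [Ne, Ideal.Quotient.eq_zero_iff_mem]
      exact fun h => hQ.ne_top (Ideal.eq_top_of_isUnit_mem _ h ha)
    -- As `a * c = b` in `C`, the class of `c` is a root of `a X - b`, whose leading coefficient is
    -- nonzero since `f a` is a unit.
    refine ⟨.C (Ideal.Quotient.mk P a) * .X - .C (Ideal.Quotient.mk P b), ?_, ?_⟩
    · intro h
      apply ha'
      simpa using congrArg (Polynomial.coeff · 1) h
    · simp only [map_sub, map_mul, Polynomial.aeval_C, Polynomial.aeval_X]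
      change Ideal.Quotient.mk Q (f a) * _ - Ideal.Quotient.mk Q (f b) = 0
      rw [← map_mul, hab, sub_self]
  have h := lift_trdeg_add_eq k (A ⧸ P) (C ⧸ Q)
  rw [trdeg_eq_zero (R := A ⧸ P), Cardinal.lift_zero, add_zero] at h
  let w : MvPolynomial (Fin s) k →ₐ[k] C ⧸ Q := (Ideal.Quotient.mkₐ k Q).comp v
  have hw : Function.Injective w := by
    rw [injective_iff_map_eq_zero]
    intro p hp
    have : p ∈ Q.comap v.toRingHom := Ideal.mem_comap.2 (Ideal.Quotient.eq_zero_iff_mem.1 hp)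
    rwa [hQv] at this
  have h2 := lift_trdeg_le_of_injective w hw
  rw [MvPolynomial.trdeg_of_isDomain] at h2
  have hs : (s : Cardinal) ≤ Algebra.trdeg k (A ⧸ P) := by
    rw [← Cardinal.lift_le, h, Cardinal.lift_natCast]
    simpa using h2
  exact (natCast_le_ringKrullDim_of_le_trdeg hs).trans (ringKrullDim_quotient_le P)

namespace RealMaps

/-! ### Dimension of rational images and of products. -/

open MvPolynomial

/-- `φ` is on `S` a tuple of quotients of polynomials whose denominators vanish nowhere on `S`. -/
def RationalOn {n m : ℕ} (S : Set (Fin n → ℝ)) (φ : (Fin n → ℝ) → (Fin m → ℝ)) : Prop :=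
  ∀ i, ∃ p q : MvPolynomial (Fin n) ℝ, (∀ x ∈ S, eval x q ≠ 0) ∧
    ∀ x ∈ S, φ x i = eval x p / eval x q

/-- The functions on `S` that are quotients of polynomials, with denominators vanishing nowhere
on `S`. -/
def regularFractions {n : ℕ} (S : Set (Fin n → ℝ)) : Subalgebra ℝ (S → ℝ) where
  carrier := {f | ∃ p q : MvPolynomial (Fin n) ℝ, (∀ x : S, eval x.1 q ≠ 0) ∧
    ∀ x : S, f x = eval x.1 p / eval x.1 q}
  mul_mem' := by
    rintro f g ⟨p, q, hq, hf⟩ ⟨p', q', hq', hg⟩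
    refine ⟨p * p', q * q', fun x => ?_, fun x => ?_⟩
    · simpa using ⟨hq x, hq' x⟩
    · simp only [Pi.mul_apply, hf, hg, map_mul, div_mul_div_comm]
  add_mem' := by
    rintro f g ⟨p, q, hq, hf⟩ ⟨p', q', hq', hg⟩
    refine ⟨p * q' + q * p', q * q', fun x => ?_, fun x => ?_⟩
    · simpa using ⟨hq x, hq' x⟩
    · simp only [Pi.add_apply, hf, hg, map_mul, map_add, div_add_div _ _ (hq x) (hq' x)]
  algebraMap_mem' r := ⟨C r, 1, by simp, by simp⟩

/-- Polynomials as functions on `S`. -/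
noncomputable def polynomialFunction {n : ℕ} (S : Set (Fin n → ℝ)) :
    MvPolynomial (Fin n) ℝ →ₐ[ℝ] regularFractions S :=
  (AlgHom.pi fun x : S => aeval x.1).codRestrict _ fun p =>
    ⟨p, 1, by simp, fun x => by simp [aeval_eq_eval]⟩

theorem polynomialFunction_apply {n : ℕ} (S : Set (Fin n → ℝ)) (p : MvPolynomial (Fin n) ℝ)
    (x : S) : (polynomialFunction S p).1 x = eval x.1 p := by
  rw [← aeval_eq_eval]
  rfl

/-- Pullback along a map `φ` that is rational on `S`. -/
noncomputable def pullback {n m : ℕ} {S : Set (Fin n → ℝ)} {φ : (Fin n → ℝ) → (Fin m → ℝ)}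
    (hφ : RationalOn S φ) : MvPolynomial (Fin m) ℝ →ₐ[ℝ] regularFractions S :=
  aeval fun i => ⟨fun x => φ x i, by
    obtain ⟨p, q, hq, h⟩ := hφ i
    exact ⟨p, q, fun x => hq x x.2, fun x => h x x.2⟩⟩

theorem pullback_apply {n m : ℕ} {S : Set (Fin n → ℝ)} {φ : (Fin n → ℝ) → (Fin m → ℝ)}
    (hφ : RationalOn S φ) (p : MvPolynomial (Fin m) ℝ) (x : S) :
    (pullback hφ p).1 x = eval (φ x) p := by
  have := comp_aeval_apply (R := ℝ)
    (fun i => (⟨fun x => φ x i, by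
      obtain ⟨p, q, hq, h⟩ := hφ i
      exact ⟨p, q, fun x => hq x x.2, fun x => h x x.2⟩⟩ : regularFractions S))
    ((Pi.evalAlgHom ℝ (fun _ : S => ℝ) x).comp (regularFractions S).val) p
  rw [← aeval_eq_eval]
  exact this

/-- Rational images do not have larger dimension. -/
theorem semialgDim_image_le {n m : ℕ} {S : Set (Fin n → ℝ)} {φ : (Fin n → ℝ) → (Fin m → ℝ)}
    (hφ : RationalOn S φ) : semialgDim (φ '' S) ≤ semialgDim S := by
  have hker : ∀ p ∈ vanishingIdeal ℝ S, polynomialFunction S p = 0 := fun p hp => by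
    ext x
    rw [polynomialFunction_apply, ← aeval_eq_eval]
    exact hp x x.2
  have hker' : ∀ p, pullback hφ p = 0 ↔ p ∈ vanishingIdeal ℝ (φ '' S) := fun p => by
    simp only [Subtype.ext_iff, funext_iff, pullback_apply, mem_vanishingIdeal_iff,
      Set.forall_mem_image, aeval_eq_eval]
    exact ⟨fun h x hx => h ⟨x, hx⟩, fun h x => h x.2⟩
  -- Here `A` and `B` are the coordinate rings of `S` and `φ '' S`, and `C` is `regularFractions S`.
  -- Pullback is injective on `B` because its kernel is exactly the vanishing ideal of `φ '' S`.
  refine ringKrullDim_le_of_injective_of_fractions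
    (Ideal.Quotient.liftₐ _ (polynomialFunction S) hker)
    (Ideal.Quotient.liftₐ _ (pullback hφ) fun p hp => (hker' p).2 hp) ?_ ?_
  · rw [injective_iff_map_eq_zero]
    intro b hb
    obtain ⟨p, rfl⟩ := Ideal.Quotient.mk_surjective b
    exact Ideal.Quotient.eq_zero_iff_mem.2 ((hker' p).1 hb)
  · rintro ⟨f, p, q, hq, hf⟩
    refine ⟨Ideal.Quotient.mk _ q, Ideal.Quotient.mk _ p, ?_, ?_⟩
    · refine IsUnit.of_mul_eq_one ⟨fun x => (eval x.1 q)⁻¹, 1, q, hq, fun x => by simp⟩ ?_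
      ext x
      exact (congrArg (· * _) (polynomialFunction_apply S q x)).trans (mul_inv_cancel₀ (hq x))
    · ext x
      refine (congrArg (· * f x) (polynomialFunction_apply S q x)).trans
        (Eq.trans ?_ (polynomialFunction_apply S p x).symm)
      rw [hf, mul_div_cancel₀ _ (hq x)]

theorem semialgDim_image_eq {n m : ℕ} {S : Set (Fin n → ℝ)} {φ : (Fin n → ℝ) → (Fin m → ℝ)}
    {ψ : (Fin m → ℝ) → (Fin n → ℝ)} (hφ : RationalOn S φ) (hψ : RationalOn (φ '' S) ψ)
    (h : Set.LeftInvOn ψ φ S) : semialgDim (φ '' S) = semialgDim S := by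
  refine (semialgDim_image_le hφ).antisymm ?_
  simpa [h.image_image] using semialgDim_image_le hψ

/-- The product of a set with a Zariski dense set. -/
theorem semialgDim_prod {n k : ℕ} (S : Set (Fin n → ℝ)) (U : Set (Fin k → ℝ))
    (hU : ∀ p : MvPolynomial (Fin k) ℝ, (∀ u ∈ U, eval u p = 0) → p = 0) :
    semialgDim {z : Fin (n + k) → ℝ | (fun i => z (Fin.castAdd k i)) ∈ S ∧
      (fun j => z (Fin.natAdd n j)) ∈ U} = semialgDim S + k := by
  set T := {z : Fin (n + k) → ℝ | (fun i => z (Fin.castAdd k i)) ∈ S ∧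
      (fun j => z (Fin.natAdd n j)) ∈ U}
  -- Read `p` as a polynomial in the last `k` variables over `ℝ[x₁, …, xₙ]`. It vanishes on the
  -- product iff its specialization at each `x ∈ S` vanishes on `U`, hence identically, that is, iff
  -- all its coefficients vanish on `S`. So the coordinate ring is a polynomial ring in `k`
  -- variables over that of `S`.
  let e : MvPolynomial (Fin (n + k)) ℝ ≃ₐ[ℝ] MvPolynomial (Fin k) (MvPolynomial (Fin n) ℝ) :=
    (renameEquiv ℝ (finSumFinEquiv.symm.trans (Equiv.sumComm (Fin n) (Fin k)))).trans
      (sumAlgEquiv ℝ (Fin k) (Fin n))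
  have he : ∀ (x : Fin n → ℝ) (u : Fin k → ℝ) p,
      eval u (map (eval x) (e p)) = eval (Fin.append x u) p := by
    intro x u p
    induction p using MvPolynomial.induction_on with
    | C a => simp [e]
    | add p q hp hq => simp only [map_add, hp, hq]
    | mul_X p i hp =>
      simp only [map_mul, hp]
      congr 1
      induction i using Fin.addCases <;> simp [e]
  let φ : MvPolynomial (Fin (n + k)) ℝ →+* MvPolynomial (Fin k)
      (MvPolynomial (Fin n) ℝ ⧸ vanishingIdeal ℝ S) :=
    (map (Ideal.Quotient.mk (vanishingIdeal ℝ S))).comp (e : _ →+* _)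
  have hφ : Function.Surjective φ :=
    (map_surjective _ Ideal.Quotient.mk_surjective).comp e.surjective
  have hker : RingHom.ker φ = vanishingIdeal ℝ T := by
    ext p
    have h1 : p ∈ RingHom.ker φ ↔ ∀ x ∈ S, map (eval x) (e p) = 0 := by
      simp only [RingHom.mem_ker, φ, RingHom.comp_apply, MvPolynomial.ext_iff, coeff_map,
        coeff_zero, RingHom.coe_coe, Ideal.Quotient.eq_zero_iff_mem, mem_vanishingIdeal_iff,
        aeval_eq_eval]
      exact ⟨fun h x hx m => h m x hx, fun h m x hx => h x hx m⟩
    rw [h1, mem_vanishingIdeal_iff]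
    refine ⟨fun h z hz => ?_, fun h x hx => hU _ fun u hu => ?_⟩
    · have := he (fun i => z (Fin.castAdd k i)) (fun j => z (Fin.natAdd n j)) p
      rw [h _ hz.1, map_zero, Fin.append_castAdd_natAdd] at this
      rw [aeval_eq_eval]
      exact this.symm
    · rw [he]
      have := h (Fin.append x u) (by simpa [T] using ⟨hx, hu⟩)
      rwa [aeval_eq_eval] at this
  rw [semialgDim, ← hker, ringKrullDim_eq_of_ringEquiv (RingHom.quotientKerEquivOfSurjective hφ),
    MvPolynomial.ringKrullDim_of_isNoetherianRing, Nat.card_fin]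
  rfl

theorem semialgCodim_eq_of_dim_eq_add {n k : ℕ} {S : Set (Fin n → ℝ)} {T : Set (Fin (n + k) → ℝ)}
    (hST : S = ∅ ↔ T = ∅) (h : semialgDim T = semialgDim S + k) :
    semialgCodim S = semialgCodim T := by
  by_cases hS : S = ∅
  · simp [semialgCodim, hS, hST.1 hS]
  have hT := fun h => hS (hST.2 h)
  obtain ⟨x, hx⟩ := Set.nonempty_iff_ne_empty.2 hS
  -- A point of `S` excludes dimension `⊥`, so the default of `unbotD` plays no role;
  -- `semialgDim_le` excludes `⊤` and truncation.
  have : Nontrivial (MvPolynomial (Fin n) ℝ ⧸ vanishingIdeal ℝ S) := by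
    refine Ideal.Quotient.nontrivial_iff.2 fun htop => ?_
    have : (1 : MvPolynomial (Fin n) ℝ) ∈ vanishingIdeal ℝ S := htop ▸ Submodule.mem_top
    simpa using this x hx
  have h0 : 0 ≤ semialgDim S := ringKrullDim_nonneg_of_nontrivial
  have hn := semialgDim_le S
  simp only [semialgCodim, if_neg hS, if_neg hT, h]
  generalize semialgDim S = d at *
  induction d with
  | bot => simp at h0
  | coe d =>
    induction d with
    | top =>
      have hn' : (⊤ : ℕ∞) ≤ n := WithBot.coe_le_coe.1 hn
      simp at hn'
    | coe d =>
      have : ((d : ℕ∞) : WithBot ℕ∞) + (k : WithBot ℕ∞) = ((d + k : ℕ∞) : WithBot ℕ∞) := rfl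
      rw [this, WithBot.unbotD_coe, WithBot.unbotD_coe]
      norm_cast
      omega

/-! ### Birational stable steps. -/

theorem EverywhereDefinedRational.rationalOn {n : ℕ} {F : Endo n}
    (hF : EverywhereDefinedRational F) (S : Set (Fin n → ℝ)) : RationalOn S F := fun i => by
  obtain ⟨p, q, hq, h⟩ := hF i
  exact ⟨p, q, fun x _ => hq x, fun x _ => h x⟩

theorem coimage_comp_equiv {n : ℕ} (F : Endo n) (A B : Equiv.Perm (Fin n → ℝ)) :
    coimage (A ∘ F ∘ B) = A '' coimage F := by
  rw [coimage, coimage, Set.image_compl_eq A.bijective, Set.range_comp, B.surjective.range_comp]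

theorem coimage_freshExtension {n k : ℕ} (F : Endo n) :
    coimage (freshExtension k F) = {z : Fin (n + k) → ℝ | (fun i => z (Fin.castAdd k i)) ∈
      coimage F ∧ (fun j => z (Fin.natAdd n j)) ∈ (Set.univ : Set (Fin k → ℝ))} := by
  ext z
  simp only [coimage, Set.mem_compl_iff, Set.mem_range, Set.mem_univ, and_true,
    Set.mem_ofPred_eq, not_iff_not]
  constructor
  · rintro ⟨x, rfl⟩
    exact ⟨fun i => x (Fin.castAdd k i), by ext i; simp [freshExtension]⟩
  · rintro ⟨x, hx⟩
    refine ⟨Fin.append x fun j => z (Fin.natAdd n j), ?_⟩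
    simp only [freshExtension, Fin.append_left, Fin.append_right, hx]
    exact Fin.append_castAdd_natAdd

theorem BirationalStableStep.semialgCodim_coimage_eq {F G : AnyEndo}
    (h : BirationalStableStep F G) :
    semialgCodim (coimage F.2) = semialgCodim (coimage G.2) := by
  cases h with
  | coordinateChange hn F A B hA hB =>
    rw [coimage_comp_equiv]
    refine semialgCodim_eq_of_dim_eq_add (k := 0) Set.image_eq_empty.symm ?_
    have := semialgDim_image_eq (hA.1.rationalOn (coimage F)) (hA.2.rationalOn _)
      fun x _ => A.symm_apply_apply x
    simpa using this
  | @fresh n k hn hk F =>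
    refine semialgCodim_eq_of_dim_eq_add (k := k) ?_ ?_
    · simp only [coimage_freshExtension, Set.mem_univ, and_true]
      refine not_iff_not.1 ?_
      simp only [← ne_eq, ← Set.nonempty_iff_ne_empty]
      exact ⟨fun ⟨x, hx⟩ => ⟨Fin.append x 0, by simpa using hx⟩, fun ⟨z, hz⟩ => ⟨_, hz⟩⟩
    · simp only [coimage_freshExtension]
      exact semialgDim_prod _ _ fun p hp => MvPolynomial.funext fun u => by simpa using hp u trivial

/-! ### Segre steps. -/

/-- The map `(x, t) ↦ (L x, t)`. -/
noncomputable def snocLinear {n : ℕ} (L : (Fin n → ℝ) →L[ℝ] (Fin n → ℝ)) :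
    (Fin (n + 1) → ℝ) →L[ℝ] (Fin (n + 1) → ℝ) :=
  ContinuousLinearMap.pi (Fin.lastCases (.proj (Fin.last n)) fun i =>
    (ContinuousLinearMap.proj i).comp (L.comp (.pi fun j => .proj j.castSucc)))

theorem snocLinear_apply {n : ℕ} (L : (Fin n → ℝ) →L[ℝ] (Fin n → ℝ)) (z : Fin (n + 1) → ℝ) :
    snocLinear L z = Fin.snoc (α := fun _ => ℝ) (L (Fin.init z)) (z (Fin.last n)) := by
  ext i
  induction i using Fin.lastCases with
  | last => simp [snocLinear]
  | cast i =>
    simp [snocLinear]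
    rfl

theorem snocLinear_surjective_iff {n : ℕ} (L : (Fin n → ℝ) →L[ℝ] (Fin n → ℝ)) :
    Function.Surjective (snocLinear L) ↔ Function.Surjective L := by
  constructor
  · intro h y
    obtain ⟨z, hz⟩ := h (Fin.snoc (α := fun _ => ℝ) y 0)
    refine ⟨Fin.init z, ?_⟩
    rw [snocLinear_apply] at hz
    simpa using congrArg (Fin.init (α := fun _ => ℝ)) hz
  · intro h y
    obtain ⟨x, hx⟩ := h (Fin.init y)
    refine ⟨Fin.snoc (α := fun _ => ℝ) x (y (Fin.last n)), ?_⟩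
    rw [snocLinear_apply]
    simp [hx]

/-- Near the origin `F(tx)` differs from `t L x` by at most `ε |t| ‖x‖`; dividing by `t` leaves an
error of at most `ε ‖x‖`. At `t = 0` and in the last coordinate there is no error. -/
theorem hasFDerivAt_segreExtension {n : ℕ} {F : Endo n} (hF : DifferentiableAt ℝ F 0)
    (h0 : F 0 = 0) : HasFDerivAt (segreExtension F) (snocLinear (fderiv ℝ F 0)) 0 := by
  set L := fderiv ℝ F 0 with hL
  refine .of_isLittleO (Asymptotics.isLittleO_iff.2 fun ε hε => ?_)
  have h1 : ∀ᶠ u in nhds (0 : Fin n → ℝ), ‖F u - L u‖ ≤ ε * ‖u‖ := by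
    simpa [h0] using Asymptotics.isLittleO_iff.1 hF.hasFDerivAt.isLittleO hε
  have hc : Filter.Tendsto (fun z : Fin (n + 1) → ℝ => z (Fin.last n) • (Fin.init z : Fin n → ℝ))
      (nhds 0) (nhds 0) := by
    have : Continuous (fun z : Fin (n + 1) → ℝ => z (Fin.last n) • (Fin.init z : Fin n → ℝ)) := by
      unfold Fin.init
      fun_prop
    simpa using this.tendsto 0
  filter_upwards [hc.eventually h1] with z hz
  have h2 : segreExtension F 0 = 0 := by
    ext i
    induction i using Fin.lastCases with
    | last => simp [segreExtension]
    | cast i =>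
      have : (Fin.init (0 : Fin (n + 1) → ℝ) : Fin n → ℝ) = 0 := rfl
      simp [segreExtension, this]
  rw [h2, sub_zero, sub_zero, snocLinear_apply]
  have hinit : ‖(Fin.init z : Fin n → ℝ)‖ ≤ ‖z‖ :=
    (pi_norm_le_iff_of_nonneg (norm_nonneg _)).2 fun i => norm_le_pi_norm z i.castSucc
  refine (pi_norm_le_iff_of_nonneg (by positivity)).2 fun i => ?_
  induction i using Fin.lastCases with
  | last =>
    simp only [segreExtension, Pi.sub_apply, Fin.snoc_last, sub_self, norm_zero]
    positivity
  | cast i =>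
    by_cases ht : z (Fin.last n) = 0
    · simp only [segreExtension, ← hL, ht, if_true, Pi.sub_apply, Fin.snoc_castSucc, sub_self, norm_zero]
      positivity
    · have hi : ‖F (z (Fin.last n) • (Fin.init z : Fin n → ℝ)) i -
          z (Fin.last n) * L (Fin.init z) i‖ ≤
          ε * (|z (Fin.last n)| * ‖(Fin.init z : Fin n → ℝ)‖) := by
        refine le_trans ?_ (hz.trans_eq (by rw [norm_smul, Real.norm_eq_abs]))
        simpa using norm_le_pi_norm (F (z (Fin.last n) • (Fin.init z : Fin n → ℝ)) -
          L (z (Fin.last n) • (Fin.init z : Fin n → ℝ))) i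
      have ht' : 0 < |z (Fin.last n)| := abs_pos.2 ht
      simp only [segreExtension, ht, if_false, Pi.sub_apply, Fin.snoc_castSucc, Pi.smul_apply,
        smul_eq_mul]
      refine le_trans ?_ (mul_le_mul_of_nonneg_left hinit hε.le)
      have h3 : (z (Fin.last n))⁻¹ * F (z (Fin.last n) • (Fin.init z : Fin n → ℝ)) i -
          L (Fin.init z) i = (z (Fin.last n))⁻¹ * (F (z (Fin.last n) • (Fin.init z : Fin n → ℝ)) i -
          z (Fin.last n) * L (Fin.init z) i) := by
        field_simp
      rw [h3, norm_mul, norm_inv, Real.norm_eq_abs, inv_mul_le_iff₀ ht']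
      linarith

/-- On `t = 0` the extension acts as `F'(0)`, which is onto; on a slice `t ≠ 0` it is `F` conjugated
by scaling. -/
theorem mem_range_segreExtension_iff {n : ℕ} {F : Endo n}
    (hF : Function.Surjective (fderiv ℝ F 0)) (y : Fin (n + 1) → ℝ) :
    y ∈ Set.range (segreExtension F) ↔
      y (Fin.last n) = 0 ∨ y (Fin.last n) • (Fin.init y : Fin n → ℝ) ∈ Set.range F := by
  constructor
  · rintro ⟨z, rfl⟩
    by_cases ht : z (Fin.last n) = 0
    · simp [segreExtension, ht]
    · right
      exact ⟨z (Fin.last n) • (Fin.init z : Fin n → ℝ), by simp [segreExtension, ht]⟩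
  · intro h
    by_cases ht : y (Fin.last n) = 0
    · obtain ⟨x, hx⟩ := hF (Fin.init y)
      refine ⟨Fin.snoc (α := fun _ => ℝ) x 0, ?_⟩
      simp only [segreExtension, Fin.snoc_last, Fin.init_snoc, if_true, hx]
      rw [← ht, Fin.snoc_init_self]
    · obtain ⟨x, hx⟩ := h.resolve_left ht
      refine ⟨Fin.snoc (α := fun _ => ℝ) ((y (Fin.last n))⁻¹ • x) (y (Fin.last n)), ?_⟩
      simp only [segreExtension, Fin.snoc_last, Fin.init_snoc, ht, if_false]
      rw [smul_inv_smul₀ ht, hx, inv_smul_smul₀ ht, Fin.snoc_init_self]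

/-- The map `(x, t) ↦ (x / t, t)`. -/
noncomputable def divLast {n : ℕ} (z : Fin (n + 1) → ℝ) : Fin (n + 1) → ℝ :=
  Fin.snoc (α := fun _ => ℝ) ((z (Fin.last n))⁻¹ • (Fin.init z : Fin n → ℝ)) (z (Fin.last n))

/-- The map `(y, t) ↦ (t y, t)`. -/
def mulLast {n : ℕ} (z : Fin (n + 1) → ℝ) : Fin (n + 1) → ℝ :=
  Fin.snoc (α := fun _ => ℝ) (z (Fin.last n) • (Fin.init z : Fin n → ℝ)) (z (Fin.last n))

theorem mulLast_divLast {n : ℕ} {z : Fin (n + 1) → ℝ} (hz : z (Fin.last n) ≠ 0) :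
    mulLast (divLast z) = z := by
  simp only [mulLast, divLast, Fin.snoc_last, Fin.init_snoc]
  rw [smul_inv_smul₀ hz, Fin.snoc_init_self]

theorem divLast_mulLast {n : ℕ} {z : Fin (n + 1) → ℝ} (hz : z (Fin.last n) ≠ 0) :
    divLast (mulLast z) = z := by
  simp only [mulLast, divLast, Fin.snoc_last, Fin.init_snoc]
  rw [inv_smul_smul₀ hz, Fin.snoc_init_self]

theorem rationalOn_divLast {n : ℕ} {S : Set (Fin (n + 1) → ℝ)}
    (hS : ∀ z ∈ S, z (Fin.last n) ≠ 0) : RationalOn S divLast := fun i => by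
  induction i using Fin.lastCases with
  | last => exact ⟨X (Fin.last n), 1, by simp, by simp [divLast]⟩
  | cast i =>
    exact ⟨X i.castSucc, X (Fin.last n), by simpa using hS, by
      simp [divLast, Fin.init, inv_mul_eq_div]⟩

theorem rationalOn_mulLast {n : ℕ} (S : Set (Fin (n + 1) → ℝ)) : RationalOn S mulLast :=
  fun i => by
  induction i using Fin.lastCases with
  | last => exact ⟨X (Fin.last n), 1, by simp, by simp [mulLast]⟩
  | cast i => exact ⟨X (Fin.last n) * X i.castSucc, 1, by simp, by simp [mulLast, Fin.init]⟩

theorem coimage_segreExtension {n : ℕ} {F : Endo n}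
    (hF : Function.Surjective (fderiv ℝ F 0)) :
    coimage (segreExtension F) = divLast ''
      {z : Fin (n + 1) → ℝ | (fun i => z (Fin.castAdd 1 i)) ∈ coimage F ∧
        (fun j => z (Fin.natAdd n j)) ∈ {u : Fin 1 → ℝ | u 0 ≠ 0}} := by
  ext y
  rw [coimage, Set.mem_compl_iff, mem_range_segreExtension_iff hF, not_or]
  constructor
  · rintro ⟨ht, hy⟩
    refine ⟨mulLast y, ⟨?_, ?_⟩, divLast_mulLast ht⟩
    · have : (fun i => mulLast y (Fin.castAdd 1 i)) = y (Fin.last n) • (Fin.init y : Fin n → ℝ) :=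
        Fin.init_snoc (α := fun _ => ℝ) _ _
      rwa [this]
    · change mulLast y (Fin.last n) ≠ 0
      simpa [mulLast] using ht
  · rintro ⟨z, ⟨hz, ht⟩, rfl⟩
    have ht : z (Fin.last n) ≠ 0 := ht
    refine ⟨by simpa [divLast] using ht, ?_⟩
    simp only [divLast, Fin.snoc_last, Fin.init_snoc, smul_inv_smul₀ ht]
    exact hz

theorem semialgCodim_coimage_segreExtension {n : ℕ} {F : Endo n}
    (hF : Function.Surjective (fderiv ℝ F 0)) :
    semialgCodim (coimage F) = semialgCodim (coimage (segreExtension F)) := by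
  rw [coimage_segreExtension hF]
  refine semialgCodim_eq_of_dim_eq_add (k := 1) ?_ ?_
  · rw [Set.image_eq_empty, ← not_iff_not]
    simp only [← ne_eq, ← Set.nonempty_iff_ne_empty]
    exact ⟨fun ⟨x, hx⟩ => ⟨Fin.append x 1, by simpa using hx⟩, fun ⟨z, hz⟩ => ⟨_, hz.1⟩⟩
  · rw [← semialgDim_prod _ {u : Fin 1 → ℝ | u 0 ≠ 0} fun p hp => ?_]
    · exact semialgDim_image_eq (rationalOn_divLast fun z hz => hz.2) (rationalOn_mulLast _)
        fun z hz => mulLast_divLast hz.2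
    -- The punctured line is Zariski dense: multiplying by `X 0` extends the vanishing of `p` to the
    -- missing point.
    · have : p * X 0 = 0 := MvPolynomial.funext fun u => by
        by_cases hu : u 0 = 0
        · simp [hu]
        · simp [hp u hu]
      exact (mul_eq_zero.1 this).resolve_right (X_ne_zero 0)

theorem SegreStep.surjective_fderiv_iff {F G : AnyEndo} (h : SegreStep F G) :
    Function.Surjective (fderiv ℝ F.2 0) ↔ Function.Surjective (fderiv ℝ G.2 0) := by
  obtain ⟨F, -, hF, h0⟩ := h
  rw [(hasFDerivAt_segreExtension (hF 0 trivial).differentiableAt h0).fderiv,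
    snocLinear_surjective_iff]

theorem SegreStep.semialgCodim_coimage_eq {F G : AnyEndo} (h : SegreStep F G)
    (hF : Function.Surjective (fderiv ℝ F.2 0)) :
    semialgCodim (coimage F.2) = semialgCodim (coimage G.2) := by
  obtain ⟨F, -⟩ := h
  exact semialgCodim_coimage_segreExtension hF

/-! ### From single steps to the equivalence relations. -/

theorem BirationallyStablyEquivalent.semialgCodim_coimage_eq {n m : ℕ} {F : Endo n} {G : Endo m}
    (h : BirationallyStablyEquivalent F G) :
    semialgCodim (coimage F) = semialgCodim (coimage G) := by
  have key : ∀ P Q : AnyEndo, Relation.EqvGen BirationalStableStep P Q →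
      semialgCodim (coimage P.2) = semialgCodim (coimage Q.2) := fun P Q h => by
    induction h with
    | rel _ _ h => exact h.semialgCodim_coimage_eq
    | refl => rfl
    | symm _ _ _ ih => exact ih.symm
    | trans _ _ _ _ _ ih ih' => exact ih.trans ih'
  exact key _ _ h

theorem SegreEquivalent.semialgCodim_coimage_eq {n m : ℕ} {F : Endo n} {G : Endo m}
    (h : SegreEquivalent F G) (hF : Function.Surjective (fderiv ℝ F 0)) :
    semialgCodim (coimage F) = semialgCodim (coimage G) := by
  -- Surjectivity at `0` is carried through the induction as an equivalence, since chains also run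
  -- backwards and only the endpoint `F` is known to have it.
  have key : ∀ P Q : AnyEndo, Relation.EqvGen SegreStep P Q →
      (Function.Surjective (fderiv ℝ P.2 0) ↔ Function.Surjective (fderiv ℝ Q.2 0)) ∧
        (Function.Surjective (fderiv ℝ P.2 0) →
          semialgCodim (coimage P.2) = semialgCodim (coimage Q.2)) := fun P Q h => by
    induction h with
    | rel _ _ h => exact ⟨h.surjective_fderiv_iff, h.semialgCodim_coimage_eq⟩
    | refl => exact ⟨.rfl, fun _ => rfl⟩
    | symm _ _ _ ih => exact ⟨ih.1.symm, fun h => (ih.2 (ih.1.2 h)).symm⟩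
    | trans _ _ _ _ _ ih ih' =>
      exact ⟨ih.1.trans ih'.1, fun h => (ih.2 h).trans (ih'.2 (ih.1.1 h))⟩
  exact (key _ _ h.2.2).2 hF

theorem Nonsingular.surjective_fderiv {n : ℕ} {F : Endo n} (hF : Nonsingular F)
    (x : Fin n → ℝ) : Function.Surjective (fderiv ℝ F x) :=
  ((fderiv ℝ F x).toContinuousLinearEquivOfDetNeZero (hF.2 x)).surjective

end RealMaps

theorem mainTheorem6 {n m : ℕ} (hn : 0 < n) (hm : 0 < m)
    (F : RealMaps.Endo n) (G : RealMaps.Endo m)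
    (hF : RealMaps.EverywhereDefinedRational F) (hF' : RealMaps.Nonsingular F)
    (hG : RealMaps.EverywhereDefinedRational G) (hG' : RealMaps.Nonsingular G)
    (hFG : RealMaps.BirationallyStablyEquivalent F G ∨ RealMaps.SegreEquivalent F G) :
    RealMaps.semialgCodim (RealMaps.coimage F) = RealMaps.semialgCodim (RealMaps.coimage G) := by
  rcases hFG with h | h
  · exact h.semialgCodim_coimage_eq
  · exact h.semialgCodim_coimage_eq (hF'.surjective_fderiv 0)
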